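/- All graphs are finite and simple. A graph is a proper circular-arc graph (respectively a proper interval graph) if it is the intersection graph of a family of arcs on a circle (respectively of intervals on a line), none of which is properly contained in another. It is reduced if no two distinct vertices have the same closed neighbourhood. A vertex is universal if it is adjacent to every other vertex. A 2-edge-colouring of a graph $G$ is a map from $E(G)$ to a set of two colours (edges sharing an end vertex may receive the same colour); it is locally complete if, for every vertex $v$ and every colour, the vertices joined to $v$ by edges of that colour induce a complete subgraph of $G$. $G$ is locally complete 2-edge-colourable if it has a locally complete 2-edge-colouring. **Theorem.** Let $G$ be a connected reduced proper circular-arc graph which is locally complete 2-edge-colourable. If the complement $\overline{G}$ is not bipartite, or $\overline{G}$ is bipartite and $G$ is a proper interval graph without a universal vertex, then $G$ has a locally complete 2-edge-colouring, and it is unique up to switching the two colours. -/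

import Mathlib

namespace SimpleGraph

variable {V : Type*}

/-- `G` is the intersection graph of the family of sets `S`: distinct vertices are adjacent
exactly when the sets assigned to them meet. -/
def IsIntersectionGraph {X : Type*} (G : SimpleGraph V) (S : V → Set X) : Prop :=
  ∀ u v : V, G.Adj u v ↔ u ≠ v ∧ (S u ∩ S v).Nonempty

/-- No member of the family is properly contained in another one
(two vertices may be assigned the same set). -/
def IsProperFamily {X : Type*} (S : V → Set X) : Prop :=
  ∀ u v : V, ¬ S u ⊂ S v

/-- A closed interval on the real line. -/
def IsLineInterval (I : Set ℝ) : Prop :=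
  ∃ a b : ℝ, a ≤ b ∧ I = Set.Icc a b

/-- A closed arc on the circle `ℝ / ℤ`, other than the whole circle:
the arc running counterclockwise from `a` to `b`. -/
def IsCircularArc (A : Set (AddCircle (1 : ℝ))) : Prop :=
  ∃ a b : ℝ, a ≤ b ∧ b < a + 1 ∧ A = (fun x : ℝ => (x : AddCircle (1 : ℝ))) '' Set.Icc a b

/-- Proper interval graphs: intersection graphs of families of intervals on the line,
none properly contained in another. -/
def IsProperIntervalGraph (G : SimpleGraph V) : Prop :=
  ∃ S : V → Set ℝ, (∀ v, IsLineInterval (S v)) ∧ IsProperFamily S ∧ G.IsIntersectionGraph S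

/-- Proper circular-arc graphs: intersection graphs of families of arcs on a circle,
none properly contained in another. -/
def IsProperCircularArcGraph (G : SimpleGraph V) : Prop :=
  ∃ S : V → Set (AddCircle (1 : ℝ)),
    (∀ v, IsCircularArc (S v)) ∧ IsProperFamily S ∧ G.IsIntersectionGraph S

/-- The closed neighbourhood `N[v]`. -/
def closedNbhd (G : SimpleGraph V) (v : V) : Set V :=
  insert v (G.neighborSet v)

/-- True twins: distinct vertices with the same closed neighbourhood. -/
def AreTrueTwins (G : SimpleGraph V) (u v : V) : Prop :=
  u ≠ v ∧ G.closedNbhd u = G.closedNbhd v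

/-- A graph is reduced if it has no true twins. -/
def IsReduced (G : SimpleGraph V) : Prop :=
  ∀ u v : V, ¬ G.AreTrueTwins u v

/-- An edge-colouring with the two colours `true` and `false` (adjacent edges may share a colour)
is locally complete if, for each vertex `v` and each colour `k`, the vertices joined to `v` by
edges of colour `k` induce a complete subgraph. -/
def IsLocallyComplete {G : SimpleGraph V} (C : G.EdgeLabeling Bool) : Prop :=
  ∀ (v : V) (k : Bool), G.IsClique {w | ∃ h : G.Adj v w, C.get v w h = k}

/-- `G` admits a locally complete 2-edge-colouring. -/
def IsLocallyCompleteColourable (G : SimpleGraph V) : Prop :=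
  ∃ C : G.EdgeLabeling Bool, IsLocallyComplete C

end SimpleGraph

/-! Given two locally complete colourings, colour each pair of vertices by "agree", "differ" or
"non-edge". Two edges from one vertex to nonadjacent vertices differ in both colourings, so no
triangle is rainbow (`rainbowFree_compareColourings`). By an argument of Gallai type, some colour is
disconnected (`RainbowFree.exists_not_connected`). Yet colour components are modules
(`isModule_component`) and `G` has only trivial ones (`IsModule.eq_univ`), so every colour that
occurs is connected. Hence one of the three is absent. It is not "non-edge", since a complete graph
has twins; so the colourings agree everywhere or differ everywhere. -/

namespace SimpleGraph

/-! ### Rainbow-free 3-colourings of complete graphs -/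

section RainbowFree

variable {V : Type*}

/-- `b` is a point of `S` joined to `a` by colour `k`. -/
def ColourStep {K : Type*} (c : V → V → K) (S : Set V) (k : K) (a b : V) : Prop :=
  b ∈ S ∧ c a b = k

/-- No triangle has three different colours. -/
def RainbowFree {K : Type*} (c : V → V → K) : Prop :=
  ∀ x y z : V, x ≠ y → x ≠ z → y ≠ z → c x y = c x z ∨ c x y = c y z ∨ c x z = c y z

open Relation

variable {K : Type*} {c : V → V → K}

theorem ColourStep.mem_of_reflTransGen {S : Set V} {k : K} {x y : V} (hx : x ∈ S)
    (h : ReflTransGen (ColourStep c S k) x y) : y ∈ S := by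
  cases h with
  | refl => exact hx
  | tail _ h => exact h.1

theorem ColourStep.reflTransGen_symm (hs : ∀ x y, c x y = c y x) {S : Set V} {k : K} {x y : V}
    (hx : x ∈ S) (h : ReflTransGen (ColourStep c S k) x y) :
    ReflTransGen (ColourStep c S k) y x := by
  induction h with
  | refl => exact .refl
  | @tail b d hb hbd ih =>
    exact .head ⟨ColourStep.mem_of_reflTransGen hx hb, (hs d b).trans hbd.2⟩ ih

/-- A point outside a colour component sees the whole component in a single colour. -/
theorem RainbowFree.eq_of_reflTransGen (hc : RainbowFree c) (hs : ∀ x y, c x y = c y x)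
    {S : Set V} {k : K} {u x y : V} (hu : u ∈ S)
    (hxu : ¬ ReflTransGen (ColourStep c S k) x u) (h : ReflTransGen (ColourStep c S k) x y) :
    c u x = c u y := by
  have key : ∀ z, ReflTransGen (ColourStep c S k) x z → u ≠ z ∧ c u z ≠ k := fun z hz =>
    ⟨fun e => hxu (e ▸ hz), fun e => hxu (hz.tail ⟨hu, (hs z u).trans e⟩)⟩
  induction h with
  | refl => rfl
  | @tail b d hb hbd ih =>
    rw [ih]
    by_cases e : b = d
    · rw [e]
    obtain ⟨h1, h2⟩ := key b hb
    obtain ⟨h3, h4⟩ := key d (hb.tail hbd)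
    rcases hc u b d h1 h3 e with h | h | h
    · exact h
    · exact absurd (h.trans hbd.2) h2
    · exact absurd (h.trans hbd.2) h4

/-- A path to the new vertex `v` leaves the component of its start by an edge ending at `v`. -/
theorem ColourStep.exists_of_reflTransGen_insert {S : Set V} {k : K} {v x : V} (hv : v ∉ S)
    (hx : x ∈ S) (h : ReflTransGen (ColourStep c (insert v S) k) x v) :
    ∃ z, ReflTransGen (ColourStep c S k) x z ∧ c z v = k := by
  have key : ∀ w, ReflTransGen (ColourStep c (insert v S) k) x w →
      (∃ z, ReflTransGen (ColourStep c S k) x z ∧ c z v = k) ∨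
        ReflTransGen (ColourStep c S k) x w := by
    intro w hw
    induction hw with
    | refl => exact Or.inr .refl
    | @tail b d _ hbd ih =>
      rcases ih with ih | ih
      · exact Or.inl ih
      · rcases hbd.1 with rfl | hd
        · exact Or.inl ⟨b, ih, hbd.2⟩
        · exact Or.inr (ih.tail ⟨hd, hbd.2⟩)
  rcases key v h with h | h
  · exact h
  · exact absurd (ColourStep.mem_of_reflTransGen hx h) hv

/-- In a colouring of a complete graph with three colours and no rainbow triangle, some colour
does not connect all vertices. -/
theorem RainbowFree.exists_not_connected {c : V → V → Fin 3} (hc : RainbowFree c)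
    (hs : ∀ x y, c x y = c y x) (S : Finset V) (hS : 2 ≤ S.card) :
    ∃ k, ∃ x ∈ S, ∃ y ∈ S, ¬ ReflTransGen (ColourStep c (S : Set V) k) x y := by
  classical
  induction S using Finset.induction_on with
  | empty => simp at hS
  | @insert v S hv ih =>
    by_contra! hcon
    have hvS : v ∉ (S : Set V) := by simpa using hv
    have last : ∀ k, ∀ x ∈ S, ∃ z ∈ S,
        ReflTransGen (ColourStep c (S : Set V) k) x z ∧ c z v = k := by
      intro k x hx
      have h := hcon k x (Finset.mem_insert_of_mem hx) v (Finset.mem_insert_self v S)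
      rw [Finset.coe_insert] at h
      obtain ⟨z, hz, hzv⟩ := ColourStep.exists_of_reflTransGen_insert hvS (by simpa using hx) h
      exact ⟨z, by simpa using ColourStep.mem_of_reflTransGen (by simpa using hx) hz, hz, hzv⟩
    rw [Finset.card_insert_of_notMem hv] at hS
    by_cases hcard : 2 ≤ S.card
    · obtain ⟨k, p, hp, q, hq, hpq⟩ := ih hcard
      obtain ⟨i, j, hik, hjk, hij⟩ : ∃ i j : Fin 3, i ≠ k ∧ j ≠ k ∧ i ≠ j := by
        clear hpq
        revert k
        decide
      have mono := fun {u x y : V} (hu : u ∈ S) =>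
        hc.eq_of_reflTransGen hs (S := (S : Set V)) (k := k) (u := u) (x := x) (y := y)
          (by simpa using hu)
      -- a vertex joined to `v` by a colour `l ≠ k` sends `l` to every other `k`-component
      have send : ∀ l, l ≠ k → ∀ x ∈ S, c x v = l → ∀ w ∈ S,
          ¬ ReflTransGen (ColourStep c (S : Set V) k) w x → c x w = l := by
        intro l hl x hx hxv w hw hwx
        obtain ⟨z, hz, hwz, hzv⟩ := last k w hw
        rw [mono hx hwx hwz]
        have hxz : x ≠ z := by rintro rfl; exact hwx hwz
        have hxk : c x z ≠ k := fun e =>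
          hwx (hwz.tail ⟨by simpa using hx, (hs z x).trans e⟩)
        rcases hc x z v hxz (by rintro rfl; exact hv hx) (by rintro rfl; exact hv hz)
          with h | h | h
        · exact h.trans hxv
        · exact absurd (h.trans hzv) hxk
        · exact absurd (hxv.symm.trans (h.trans hzv)) hl
      obtain ⟨x, hx, -, hxv⟩ := last i p hp
      obtain ⟨y, hy, -, hyv⟩ := last j p hp
      have symm : ∀ {a b : V}, a ∈ S → ReflTransGen (ColourStep c (S : Set V) k) a b →
          ReflTransGen (ColourStep c (S : Set V) k) b a := fun ha =>
        ColourStep.reflTransGen_symm hs (by simpa using ha)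
      -- If `x` and `y` share a `k`-component, a vertex `w` of another component sees it in both
      -- colours `i` and `j`; otherwise the pair `x`, `y` itself gets both.
      by_cases hxy : ReflTransGen (ColourStep c (S : Set V) k) x y
      · obtain ⟨w, hw, hxw⟩ : ∃ w ∈ S, ¬ ReflTransGen (ColourStep c (S : Set V) k) x w := by
          by_contra! hall
          exact hpq ((symm hx (hall p hp)).trans (hall q hq))
        have h1 := send i hik x hx hxv w hw fun h => hxw (symm hw h)
        have h2 := send j hjk y hy hyv w hw fun h => hxw (hxy.trans (symm hw h))
        have h3 := mono hw hxw hxy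
        rw [hs w x, hs w y, h1, h2] at h3
        exact hij h3
      · have h1 := send i hik x hx hxv y hy fun h => hxy (symm hy h)
        have h2 := send j hjk y hy hyv x hx hxy
        exact hij (h1.symm.trans ((hs x y).trans h2))
    · obtain ⟨u, rfl⟩ := Finset.card_eq_one.mp (by omega : S.card = 1)
      obtain ⟨z, hz, -, h0⟩ := last 0 u (by simp)
      obtain ⟨z', hz', -, h1⟩ := last 1 u (by simp)
      rw [Finset.mem_singleton] at hz hz'
      subst hz hz'
      exact absurd (h0.symm.trans h1) (by decide)

end RainbowFree

/-! ### Modules and primality -/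

variable {V : Type*} {G : SimpleGraph V}

/-- A module: vertices outside `M` do not distinguish the vertices of `M`. -/
def IsModule (G : SimpleGraph V) (M : Set V) : Prop :=
  ∀ u ∉ M, ∀ x ∈ M, ∀ y ∈ M, G.Adj u x → G.Adj u y

/-- A clique that is a module with two vertices consists of true twins. -/
theorem IsModule.areTrueTwins {M : Set V} (hM : G.IsModule M) (hK : G.IsClique M) {x y : V}
    (hx : x ∈ M) (hy : y ∈ M) (hxy : x ≠ y) : G.AreTrueTwins x y := by
  refine ⟨hxy, ?_⟩
  have key : ∀ x ∈ M, ∀ y ∈ M, G.closedNbhd x ⊆ G.closedNbhd y := by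
    rintro x hx y hy w (rfl | hw)
    · by_cases h : y = w
      · exact Or.inl h.symm
      · exact Or.inr (hK hy hx h)
    · by_cases hwM : w ∈ M
      · by_cases h : y = w
        · exact Or.inl h.symm
        · exact Or.inr (hK hy hwM h)
      · exact Or.inr (hM w hwM x hx y hy hw.symm).symm
  exact (key x hx y hy).antisymm (key y hy x hx)

/-- A connected graph has an edge leaving each nonempty proper vertex set. -/
theorem Connected.exists_adj_of_ne_univ (hG : G.Connected) {A : Set V} (hA : A.Nonempty)
    (hA' : A ≠ Set.univ) : ∃ a ∈ A, ∃ b ∉ A, G.Adj a b := by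
  obtain ⟨a, ha⟩ := hA
  obtain ⟨b, hb⟩ := (Set.ne_univ_iff_exists_notMem A).mp hA'
  obtain ⟨p⟩ := hG.preconnected a b
  obtain ⟨d, -, h1, h2⟩ := p.exists_boundary_dart A ha hb
  exact ⟨d.fst, h1, d.snd, h2, d.adj⟩

theorem IsLocallyComplete.adj {C : G.EdgeLabeling Bool} (hC : IsLocallyComplete C) {v x y : V}
    (hx : G.Adj v x) (hy : G.Adj v y) (hxy : x ≠ y) (h : C.get v x hx = C.get v y hy) :
    G.Adj x y :=
  hC v (C.get v y hy) ⟨hx, h⟩ ⟨hy, rfl⟩ hxy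

/-- In a connected locally complete 2-edge-colourable graph, a proper module containing two
nonadjacent vertices is joined completely to the rest of the graph. -/
theorem IsModule.adj_of_notMem (hG : G.Connected) {C : G.EdgeLabeling Bool}
    (hC : IsLocallyComplete C) {M : Set V} (hM : G.IsModule M) {p q : V} (hp : p ∈ M)
    (hq : q ∈ M) (hpq : p ≠ q) (hn : ¬ G.Adj p q) {w x : V} (hw : w ∉ M) (hx : x ∈ M) :
    G.Adj w x := by
  by_contra hwx
  obtain ⟨a, ⟨haM, ha⟩, b, hb, hab⟩ := hG.exists_adj_of_ne_univ
    (A := {u | u ∉ M ∧ ∀ y ∈ M, ¬ G.Adj u y})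
    ⟨w, hw, fun y hy h => hwx (hM w hw y hy x hx h)⟩
    (fun h => (h ▸ Set.mem_univ p : p ∈ {u | u ∉ M ∧ ∀ y ∈ M, ¬ G.Adj u y}).1 hp)
  have hbM : b ∉ M := fun h => ha b h hab
  obtain ⟨y, hy, hby⟩ : ∃ y ∈ M, G.Adj b y := by
    by_contra! h
    exact hb ⟨hbM, h⟩
  have hbp := hM b hbM y hy p hp hby
  have hbq := hM b hbM y hy q hq hby
  -- The vertex `b` has three pairwise nonadjacent neighbours `p`, `q`, `a`, but only two colours.
  have h1 := fun h => hn (hC.adj hbp hbq hpq h)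
  have h2 := fun h => ha p hp (hC.adj hab.symm hbp (by rintro rfl; exact haM hp) h)
  have h3 := fun h => ha q hq (hC.adj hab.symm hbq (by rintro rfl; exact haM hq) h)
  revert h1 h2 h3
  cases C.get b p hbp <;> cases C.get b q hbq <;> cases C.get b a hab.symm <;> simp

/-- If `V` is the complete join of `M` and `Mᶜ`, both nonempty, then a locally complete
2-edge-colouring covers `G` by two cliques. -/
theorem IsLocallyComplete.isBipartite_compl_of_join {C : G.EdgeLabeling Bool}
    (hC : IsLocallyComplete C) {M : Set V} {p z : V} (hp : p ∈ M) (hz : z ∉ M)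
    (hj : ∀ w ∉ M, ∀ x ∈ M, G.Adj w x) : Gᶜ.IsBipartite := by
  classical
  have col : Gᶜ.Coloring Bool := Coloring.mk
    -- Each side is split by the colours of the edges to one vertex of the other side; pairs across
    -- the join are adjacent anyway.
    (fun v => if h : v ∈ M then C.get z v (hj z hz v h) else C.get p v (hj v h p hp).symm) (by
      intro v w hvw h
      rw [compl_adj] at hvw
      refine hvw.2 ?_
      by_cases hv : v ∈ M <;> by_cases hw : w ∈ M <;> simp only [hv, hw, dite_true, dite_false] at h
      · exact hC.adj _ _ hvw.1 h
      · exact (hj w hw v hv).symm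
      · exact hj v hv w hw
      · exact hC.adj _ _ hvw.1 h)
  simpa using col.colorable

/-- Graphs represented by intervals on the line have no induced 4-cycle. -/
theorem IsProperIntervalGraph.adj_of_common_neighbours (hG : G.IsProperIntervalGraph)
    {p q r s : V} (hpq : p ≠ q) (hn : ¬ G.Adj p q) (hrs : r ≠ s) (hpr : G.Adj p r)
    (hps : G.Adj p s) (hqr : G.Adj q r) (hqs : G.Adj q s) : G.Adj r s := by
  obtain ⟨S, hS, -, hI⟩ := hG
  choose a b hab hSe using hS
  have adj : ∀ u v, u ≠ v → (G.Adj u v ↔ a u ≤ b v ∧ a v ≤ b u) := by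
    intro u v huv
    rw [hI, hSe, hSe, Set.Icc_inter_Icc, Set.nonempty_Icc, max_le_iff, le_min_iff, le_min_iff]
    have := hab u
    have := hab v
    tauto
  rw [adj _ _ hpr.ne] at hpr
  rw [adj _ _ hps.ne] at hps
  rw [adj _ _ hqr.ne] at hqr
  rw [adj _ _ hqs.ne] at hqs
  rw [adj _ _ hpq, not_and_or, not_le, not_le] at hn
  rw [adj _ _ hrs]
  rcases hn with hn | hn <;> constructor <;> linarith

/-- The graphs of the theorem are prime: their modules are trivial. -/
theorem IsModule.eq_univ (hconn : G.Connected) (hred : G.IsReduced)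
    {C : G.EdgeLabeling Bool} (hC : IsLocallyComplete C)
    (h : ¬ Gᶜ.IsBipartite ∨ (G.IsProperIntervalGraph ∧ ¬ ∃ v : V, G.IsUniversal v))
    {M : Set V} (hM : G.IsModule M) {x y : V} (hx : x ∈ M) (hy : y ∈ M) (hxy : x ≠ y) :
    M = Set.univ := by
  by_contra hMu
  obtain ⟨z, hz⟩ := (Set.ne_univ_iff_exists_notMem M).mp hMu
  obtain ⟨p, hp, q, hq, hpq, hn⟩ : ∃ p ∈ M, ∃ q ∈ M, p ≠ q ∧ ¬ G.Adj p q := by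
    by_contra! hK
    exact hred x y (hM.areTrueTwins (fun p hp q hq => hK p hp q hq) hx hy hxy)
  have hj : ∀ w ∉ M, ∀ x ∈ M, G.Adj w x := fun w hw x hx =>
    hM.adj_of_notMem hconn hC hp hq hpq hn hw hx
  rcases h with h | ⟨hI, hU⟩
  · exact h (hC.isBipartite_compl_of_join hp hz hj)
  · refine hU ⟨z, fun w hzw => ?_⟩
    by_cases hw : w ∈ M
    · exact hj z hz w hw
    -- A non-neighbour of `z` outside `M` would form an induced 4-cycle with `z`, `p`, `q`.
    · exact hI.adj_of_common_neighbours hpq hn hzw (hj z hz p hp).symm (hj w hw p hp).symm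
        (hj z hz q hq).symm (hj w hw q hq).symm

/-! ### Comparing two colourings -/

open Classical in
/-- The comparison of two edge colourings: `0` where they agree, `1` where they differ,
`2` on non-edges. -/
noncomputable def compareColourings (C C' : G.EdgeLabeling Bool) (u v : V) : Fin 3 :=
  if h : G.Adj u v then if C.get u v h = C'.get u v h then 0 else 1 else 2

theorem compareColourings_comm (C C' : G.EdgeLabeling Bool) (u v : V) :
    compareColourings C C' u v = compareColourings C C' v u := by
  unfold compareColourings
  by_cases h : G.Adj u v
  · rw [dif_pos h, dif_pos h.symm, C.get_comm, C'.get_comm]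
  · rw [dif_neg h, dif_neg fun h' => h h'.symm]

theorem compareColourings_eq_two_iff (C C' : G.EdgeLabeling Bool) (u v : V) :
    compareColourings C C' u v = 2 ↔ ¬ G.Adj u v := by
  unfold compareColourings
  split_ifs with h <;> simp [h]

theorem compareColourings_eq_zero_iff {C C' : G.EdgeLabeling Bool} {u v : V} (h : G.Adj u v) :
    compareColourings C C' u v = 0 ↔ C.get u v h = C'.get u v h := by
  unfold compareColourings
  rw [dif_pos h]
  split_ifs with h <;> simp [h]

/-- Local completeness forces the two edges to have different colours in each colouring, so
switching from one edge to the other flips both values. -/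
theorem compareColourings_eq_of_not_adj {C C' : G.EdgeLabeling Bool} (hC : IsLocallyComplete C)
    (hC' : IsLocallyComplete C') {u v w : V} (huv : G.Adj u v) (huw : G.Adj u w) (hvw : v ≠ w)
    (hn : ¬ G.Adj v w) : compareColourings C C' u v = compareColourings C C' u w := by
  unfold compareColourings
  rw [dif_pos huv, dif_pos huw]
  have h1 := fun h => hn (hC.adj huv huw hvw h)
  have h2 := fun h => hn (hC'.adj huv huw hvw h)
  revert h1 h2
  cases C.get u v huv <;> cases C.get u w huw <;> cases C'.get u v huv <;>
    cases C'.get u w huw <;> simp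

theorem rainbowFree_compareColourings {C C' : G.EdgeLabeling Bool} (hC : IsLocallyComplete C)
    (hC' : IsLocallyComplete C') : RainbowFree (compareColourings C C') := by
  intro x y z hxy hxz hyz
  have h1 := compareColourings_eq_two_iff C C' x y
  have h2 := compareColourings_eq_two_iff C C' x z
  have h3 := compareColourings_eq_two_iff C C' y z
  by_cases a : G.Adj x y <;> by_cases b : G.Adj x z <;> by_cases d : G.Adj y z
  · revert h1 h2 h3
    generalize compareColourings C C' x y = i
    generalize compareColourings C C' x z = j
    generalize compareColourings C C' y z = k
    simp only [a, b, d]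
    revert i j k
    decide
  · exact Or.inl (compareColourings_eq_of_not_adj hC hC' a b hyz d)
  · right; left
    rw [compareColourings_comm C C' x y]
    exact compareColourings_eq_of_not_adj hC hC' a.symm d hxz b
  · exact Or.inr (Or.inr ((h2.mpr b).trans (h3.mpr d).symm))
  · right; right
    rw [compareColourings_comm C C' x z, compareColourings_comm C C' y z]
    exact compareColourings_eq_of_not_adj hC hC' b.symm d.symm hxy a
  · exact Or.inr (Or.inl ((h1.mpr a).trans (h3.mpr d).symm))
  · exact Or.inl ((h1.mpr a).trans (h2.mpr b).symm)
  · exact Or.inl ((h1.mpr a).trans (h2.mpr b).symm)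

/-- A component of one of the three comparison colours is a module. -/
theorem isModule_component {C C' : G.EdgeLabeling Bool} (hC : IsLocallyComplete C)
    (hC' : IsLocallyComplete C') (k : Fin 3) (a : V) :
    G.IsModule {b | Relation.ReflTransGen
      (ColourStep (compareColourings C C') Set.univ k) a b} := by
  intro u hu x hx y hy hux
  have mono := fun z => (rainbowFree_compareColourings hC hC').eq_of_reflTransGen
    (compareColourings_comm C C') (y := z) (Set.mem_univ u) hu
  -- The vertex `u` sees the whole component in one comparison colour, which also decides adjacency.
  have hxy := (mono x hx).symm.trans (mono y hy)
  by_contra huy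
  rw [← compareColourings_eq_two_iff C C' u y, ← hxy, compareColourings_eq_two_iff] at huy
  exact huy hux

/-- In a prime graph two locally complete 2-edge-colourings agree everywhere or nowhere. -/
theorem IsLocallyComplete.eq_or_eq_not [Finite V] (hred : G.IsReduced)
    (hprime : ∀ M : Set V, G.IsModule M → ∀ x ∈ M, ∀ y ∈ M, x ≠ y → M = Set.univ)
    {C C' : G.EdgeLabeling Bool} (hC : IsLocallyComplete C) (hC' : IsLocallyComplete C') :
    C' = C ∨ C' = C.compRight Bool.not := by
  by_contra! hne
  obtain ⟨h0, h1⟩ := hne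
  set c := compareColourings C C' with hc
  have used0 : ∃ a b, a ≠ b ∧ c a b = 0 := by
    by_contra! hno
    refine h1 (EdgeLabeling.ext_get fun x y h => ?_)
    have := hno x y h.ne
    rw [Ne, hc, compareColourings_eq_zero_iff h] at this
    rw [EdgeLabeling.compRight_get]
    revert this
    cases C.get x y h <;> cases C'.get x y h <;> simp
  have used1 : ∃ a b, a ≠ b ∧ c a b = 1 := by
    by_contra! hno
    refine h0 (EdgeLabeling.ext_get fun x y h => ?_)
    have h1 := hno x y h.ne
    have h2 := (compareColourings_eq_two_iff C C' x y).not.mpr (not_not.mpr h)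
    refine ((compareColourings_eq_zero_iff h).mp ?_).symm
    rw [← hc] at h2 ⊢
    omega
  obtain ⟨a, b, hab, h0ab⟩ := used0
  have used2 : ∃ a b, a ≠ b ∧ c a b = 2 := by
    by_contra! hno
    have hK : G.IsClique Set.univ := fun x _ y _ hxy => by
      by_contra hn
      exact hno x y hxy ((compareColourings_eq_two_iff C C' x y).mpr hn)
    have hM : G.IsModule Set.univ := fun u hu => absurd (Set.mem_univ u) hu
    exact hred a b (hM.areTrueTwins hK trivial trivial hab)
  have used : ∀ k, ∃ a b, a ≠ b ∧ c a b = k := by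
    intro k
    fin_cases k
    exacts [⟨a, b, hab, h0ab⟩, used1, used2]
  have := Fintype.ofFinite V
  obtain ⟨k, x, -, y, -, hxy⟩ := (rainbowFree_compareColourings hC hC').exists_not_connected
    (compareColourings_comm C C') Finset.univ (by
      rw [Finset.card_univ]
      exact Fintype.one_lt_card_iff.mpr ⟨a, b, hab⟩)
  rw [Finset.coe_univ] at hxy
  obtain ⟨u, v, huv, hk⟩ := used k
  have step : ColourStep c Set.univ k u v := ⟨trivial, hk⟩
  -- The component of `u` contains the distinct vertex `v`, so by primality it is everything.
  have hu := hprime _ (isModule_component hC hC' k u) u .refl v (.single step) huv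
  have reach : ∀ w, Relation.ReflTransGen (ColourStep c Set.univ k) u w := fun w =>
    Set.eq_univ_iff_forall.mp hu w
  exact hxy ((ColourStep.reflTransGen_symm (compareColourings_comm C C') (Set.mem_univ u)
    (reach x)).trans (reach y))

end SimpleGraph

theorem mainTheorem9 {V : Type*} [Finite V] (G : SimpleGraph V)
    (hconn : G.Connected) (hred : G.IsReduced) (hpca : G.IsProperCircularArcGraph)
    (hcol : G.IsLocallyCompleteColourable)
    (h : ¬ Gᶜ.IsBipartite ∨
      (Gᶜ.IsBipartite ∧ G.IsProperIntervalGraph ∧ ¬ ∃ v : V, G.IsUniversal v)) :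
    ∃ C : G.EdgeLabeling Bool, SimpleGraph.IsLocallyComplete C ∧
      ∀ C' : G.EdgeLabeling Bool, SimpleGraph.IsLocallyComplete C' →
        C' = C ∨ C' = C.compRight Bool.not := by
  obtain ⟨C, hC⟩ := hcol
  refine ⟨C, hC, fun C' hC' => hC.eq_or_eq_not hred (fun M hM x hx y hy hxy => ?_) hC'⟩
  exact hM.eq_univ hconn hred hC (h.imp_right And.right) hx hy hxy
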